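/- Let $0<p\le 1$ and let $(M,d)$ be an infinite separable ultrametric space (a metric space with $d(x,z)\le\max\{d(x,y),d(y,z)\}$ for all $x,y,z\in M$) with a distinguished point $0\in M$. Then the Lipschitz free $p$-space $\mathcal F_p(M,d)$ is isomorphic to the real sequence space $\ell_p$, i.e. there is a linear bijection $T\colon\mathcal F_p(M,d)\to\ell_p$ such that $T$ and $T^{-1}$ are bounded. Here a $p$-norm on a real vector space $Y$ is a map $\|\cdot\|_Y\colon Y\to[0,\infty)$ such that $\|y\|_Y>0$ for $y\ne0$, $\|\alpha y\|_Y=|\alpha|\,\|y\|_Y$ for $\alpha\in\mathbb R$, and $\|y+z\|_Y^p\le\|y\|_Y^p+\|z\|_Y^p$. Let $\mathbb R^M_0$ be the vector space of all functions $f\colon M\to\mathbb R$ with $f(0)=0$, and let $\mathcal P(M)$ be the linear span, in the algebraic dual of $\mathbb R^M_0$, of the evaluations $\delta(x)\colon f\mapsto f(x)$, $x\in M$. The space $\mathcal F_p(M,d)$ is the completion of $\mathcal P(M)$ with respect to the $p$-norm $$\Big\|\sum_{j=1}^N a_j\,\delta(x_j)\Big\|_{\mathcal F_p(M,d)}=\sup\Big\|\sum_{j=1}^N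 a_j f(x_j)\Big\|_Y,$$ where the supremum is taken over all $p$-normed spaces $(Y,\|\cdot\|_Y)$ and all maps $f\colon M\to Y$ with $f(0)=0$ and $\|f(x)-f(y)\|_Y\le d(x,y)$ for all $x,y\in M$. -/

import Mathlib

noncomputable section

/-- A `p`-norm on a real vector space: `N x > 0` for `x ≠ 0`, `N (c x) = |c| N x`, and
`N (x + y) ^ p ≤ N x ^ p + N y ^ p`. -/
structure IsPNorm (p : ℝ) {Y : Type*} [AddCommGroup Y] [Module ℝ Y] (N : Y → ℝ) : Prop where
  pos : ∀ x, x ≠ 0 → 0 < N x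
  smul : ∀ (c : ℝ) (x : Y), N (c • x) = |c| * N x
  add : ∀ x y, N (x + y) ^ p ≤ N x ^ p + N y ^ p

/-- Two real vector spaces with quasi-norms `N₁`, `N₂` are isomorphic: there is a linear bijection
which is bounded with bounded inverse. -/
def QuasiNormIsomorphic {X Y : Type*} [AddCommGroup X] [Module ℝ X] [AddCommGroup Y] [Module ℝ Y]
    (N₁ : X → ℝ) (N₂ : Y → ℝ) : Prop :=
  ∃ T : X ≃ₗ[ℝ] Y, ∃ C : ℝ, 0 < C ∧
    (∀ x, N₂ (T x) ≤ C * N₁ x) ∧ (∀ y, N₁ (T.symm y) ≤ C * N₂ y)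

namespace LipFree

universe u

variable {M : Type u}

/-- The space of all real functions on `M` that vanish at the base point `o`. -/
def R0 (o : M) : Submodule ℝ (M → ℝ) where
  carrier := {f | f o = 0}
  add_mem' := by
    intro f g hf hg
    simp only [Set.mem_ofPred_eq] at hf hg
    simp [hf, hg]
  zero_mem' := rfl
  smul_mem' := by
    intro c f hf
    simp only [Set.mem_ofPred_eq] at hf
    simp [hf]

/-- The evaluation functional at `x`, an element of the algebraic dual of `R0 o`. -/
def delta (o x : M) : Module.Dual ℝ (R0 o) where
  toFun f := (f : M → ℝ) x
  map_add' _ _ := rfl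
  map_smul' _ _ := rfl

/-- The linear span of the evaluations. It is a type synonym that carries the exponent `p` and the
distance `ρ`, since its topology depends on them. -/
def PSpan (_p : Set.Ioc (0 : ℝ) 1) (_ρ : M → M → ℝ) (o : M) : Type u :=
  ↥(Submodule.span ℝ (Set.range (delta o)))

variable (p : Set.Ioc (0 : ℝ) 1) (ρ : M → M → ℝ) (o : M)

instance : AddCommGroup (PSpan p ρ o) :=
  inferInstanceAs (AddCommGroup ↥(Submodule.span ℝ (Set.range (delta o))))

instance : Module ℝ (PSpan p ρ o) :=
  inferInstanceAs (Module ℝ ↥(Submodule.span ℝ (Set.range (delta o))))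

/-- The evaluation at `x` as an element of the span. -/
def PSpan.delta (x : M) : PSpan p ρ o :=
  ⟨LipFree.delta o x, Submodule.subset_span ⟨x, rfl⟩⟩

/-- The inclusion of the span into the algebraic dual. -/
def PSpan.incl : PSpan p ρ o →ₗ[ℝ] Module.Dual ℝ (R0 o) :=
  Submodule.subtype (Submodule.span ℝ (Set.range (LipFree.delta o)))

variable {p ρ o}

theorem PSpan.incl_injective : Function.Injective (PSpan.incl p ρ o) :=
  Subtype.val_injective

theorem PSpan.incl_sum (a : M →₀ ℝ) :
    PSpan.incl p ρ o (a.sum fun x c => c • PSpan.delta p ρ o x) =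
      a.sum fun x c => c • LipFree.delta o x := by
  simp only [Finsupp.sum, map_sum, map_smul]
  rfl

theorem sum_smul_smul {Z : Type*} [AddCommGroup Z] [Module ℝ Z] (c : ℝ) (b : M →₀ ℝ) (g : M → Z) :
    ((c • b).sum fun x r => r • g x) = c • b.sum fun x r => r • g x :=
  map_smul (Finsupp.linearCombination ℝ g) c b

theorem sum_add_smul {Z : Type*} [AddCommGroup Z] [Module ℝ Z] (b c : M →₀ ℝ) (g : M → Z) :
    ((b + c).sum fun x r => r • g x) = (b.sum fun x r => r • g x) + c.sum fun x r => r • g x :=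
  map_add (Finsupp.linearCombination ℝ g) b c

/-- All the numbers `‖∑ a_j f(x_j)‖_Y`, where `μ = ∑ a_j δ(x_j)`, `Y` is a `p`-normed space and
`f : M → Y` is `1`-Lipschitz with `f(0) = 0`. The spaces `Y` range over the universe of `M`; this
is no restriction, since `Y` may be replaced by the span of `f(M)`, which is linearly isomorphic to
a quotient of the span of the evaluations. -/
def normSet (μ : PSpan p ρ o) : Set ℝ :=
  {r | ∃ (Y : Type u) (_ : AddCommGroup Y) (_ : Module ℝ Y) (N : Y → ℝ) (f : M → Y),
    IsPNorm (p : ℝ) N ∧ f o = 0 ∧ (∀ x y, N (f x - f y) ≤ ρ x y) ∧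
    ∃ a : M →₀ ℝ, (a.sum fun x c => c • PSpan.delta p ρ o x) = μ ∧
      r = N (a.sum fun x c => c • f x)}

/-- The `p`-seminorm `‖μ‖ = sup ‖∑ a_j f(x_j)‖_Y` on the span of the evaluations. -/
def pnorm (μ : PSpan p ρ o) : ℝ := sSup (normSet μ)

theorem IsPNorm.map_zero' {q : ℝ} {Y : Type*} [AddCommGroup Y] [Module ℝ Y] {N : Y → ℝ}
    (h : IsPNorm q N) : N 0 = 0 := by
  simpa using h.smul 0 0

theorem IsPNorm.nonneg' {q : ℝ} {Y : Type*} [AddCommGroup Y] [Module ℝ Y] {N : Y → ℝ}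
    (h : IsPNorm q N) (x : Y) : 0 ≤ N x := by
  by_cases hx : x = 0
  · rw [hx, IsPNorm.map_zero' h]
  · exact (h.pos x hx).le

theorem exists_rep (μ : PSpan p ρ o) :
    ∃ a : M →₀ ℝ, (a.sum fun x c => c • PSpan.delta p ρ o x) = μ := by
  obtain ⟨a, ha⟩ := (Finsupp.mem_span_range_iff_exists_finsupp).1
    (show PSpan.incl p ρ o μ ∈ Submodule.span ℝ (Set.range (LipFree.delta o)) from Subtype.property _)
  exact ⟨a, PSpan.incl_injective ((PSpan.incl_sum a).trans ha)⟩

theorem rep_zero (a : M →₀ ℝ) (ha : (a.sum fun x c => c • PSpan.delta p ρ o x) = 0)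
    {Y : Type*} [AddCommGroup Y] [Module ℝ Y] (f : M → Y) (hf : f o = 0) :
    (a.sum fun x c => c • f x) = 0 := by
  classical
  have key : ∀ x, x ≠ o → a x = 0 := by
    intro x hx
    have h1 : (a.sum fun x c => c • LipFree.delta o x) = 0 := by
      rw [← PSpan.incl_sum (p := p) (ρ := ρ), ha, map_zero]
    let g : R0 o := ⟨Pi.single x 1, by
      change (Pi.single x (1 : ℝ) : M → ℝ) o = 0
      exact Pi.single_eq_of_ne (Ne.symm hx) _⟩
    have h2 := congrArg (fun L : Module.Dual ℝ (R0 o) => L g) h1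
    simp only [Finsupp.sum, LinearMap.sum_apply, LinearMap.smul_apply, LinearMap.zero_apply] at h2
    have h3 : ∀ y, LipFree.delta o y g = if y = x then 1 else 0 := by
      intro y
      change (Pi.single x (1 : ℝ) : M → ℝ) y = _
      simp [Pi.single_apply]
    simp only [h3, smul_eq_mul, mul_ite, mul_one, mul_zero, Finset.sum_ite_eq'] at h2
    by_contra hne
    rw [if_pos (Finsupp.mem_support_iff.2 hne)] at h2
    exact hne h2
  refine Finset.sum_eq_zero fun x _ => ?_
  by_cases hx : x = o
  · simp [hx, hf]
  · simp [key x hx]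

theorem rep_unique {a b : M →₀ ℝ} (hab : (a.sum fun x c => c • PSpan.delta p ρ o x) =
      b.sum fun x c => c • PSpan.delta p ρ o x)
    {Y : Type*} [AddCommGroup Y] [Module ℝ Y] (f : M → Y) (hf : f o = 0) :
    (a.sum fun x c => c • f x) = b.sum fun x c => c • f x := by
  have h0 : ((a - b).sum fun x c => c • f x) = 0 := by
    refine rep_zero (p := p) (ρ := ρ) (o := o) (a - b) ?_ f hf
    rw [Finsupp.sum_sub_index fun x c d => sub_smul c d _, hab, sub_self]
  rwa [Finsupp.sum_sub_index fun x c d => sub_smul c d _, sub_eq_zero] at h0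

theorem normSet_bddAbove (μ : PSpan p ρ o) : BddAbove (normSet μ) := by
  obtain ⟨b, hb⟩ := exists_rep μ
  have hp := p.2.1
  refine ⟨(∑ x ∈ b.support, (|b x| * ρ x o) ^ (p : ℝ)) ^ (1 / (p : ℝ)), ?_⟩
  rintro r ⟨Y, _, _, N, f, hN, hf0, hf, a, ha, rfl⟩
  rw [rep_unique (p := p) (ρ := ρ) (ha.trans hb.symm) f hf0]
  have h1 : ∀ s : Finset M, N (∑ x ∈ s, b x • f x) ^ (p : ℝ) ≤
      ∑ x ∈ s, (|b x| * ρ x o) ^ (p : ℝ) := by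
    classical
    intro s
    induction s using Finset.induction_on with
    | empty => simp [IsPNorm.map_zero' hN, Real.zero_rpow hp.ne']
    | insert x s hx ih =>
      rw [Finset.sum_insert hx, Finset.sum_insert hx]
      refine (hN.add _ _).trans (add_le_add ?_ ih)
      refine Real.rpow_le_rpow (IsPNorm.nonneg' hN _) ?_ hp.le
      rw [hN.smul]
      have := hf x o
      rw [hf0, sub_zero] at this
      exact mul_le_mul_of_nonneg_left this (abs_nonneg _)
  have h2 := Real.rpow_le_rpow (Real.rpow_nonneg (IsPNorm.nonneg' hN _) _) (h1 b.support)
    (one_div_nonneg.2 hp.le)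
  rwa [← Real.rpow_mul (IsPNorm.nonneg' hN _), mul_one_div_cancel hp.ne', Real.rpow_one] at h2

theorem normSet_nonneg (μ : PSpan p ρ o) {r : ℝ} (hr : r ∈ normSet μ) : 0 ≤ r := by
  obtain ⟨Y, _, _, N, f, hN, -, -, a, -, rfl⟩ := hr
  exact IsPNorm.nonneg' hN _

theorem pnorm_nonneg (μ : PSpan p ρ o) : 0 ≤ pnorm μ :=
  Real.sSup_nonneg fun _ => normSet_nonneg μ

theorem pnorm_add (μ ν : PSpan p ρ o) :
    pnorm (μ + ν) ^ (p : ℝ) ≤ pnorm μ ^ (p : ℝ) + pnorm ν ^ (p : ℝ) := by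
  have hp := p.2.1
  have hnn : 0 ≤ pnorm μ ^ (p : ℝ) + pnorm ν ^ (p : ℝ) :=
    add_nonneg (Real.rpow_nonneg (pnorm_nonneg _) _) (Real.rpow_nonneg (pnorm_nonneg _) _)
  have h : pnorm (μ + ν) ≤ (pnorm μ ^ (p : ℝ) + pnorm ν ^ (p : ℝ)) ^ (1 / (p : ℝ)) := by
    refine Real.sSup_le ?_ (Real.rpow_nonneg hnn _)
    rintro r ⟨Y, i1, i2, N, f, hN, hf0, hf, a, ha, rfl⟩
    obtain ⟨b, hb⟩ := exists_rep μ
    obtain ⟨c, hc⟩ := exists_rep ν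
    have hs : (a.sum fun x c => c • f x) =
        (b.sum fun x c => c • f x) + c.sum fun x c => c • f x := by
      rw [rep_unique (p := p) (ρ := ρ) (b := b + c) _ f hf0]
      · exact sum_add_smul b c f
      · rw [ha, sum_add_smul, hb, hc]
    have hb' : N (b.sum fun x c => c • f x) ≤ pnorm μ :=
      le_csSup (normSet_bddAbove μ) ⟨Y, i1, i2, N, f, hN, hf0, hf, b, hb, rfl⟩
    have hc' : N (c.sum fun x c => c • f x) ≤ pnorm ν :=
      le_csSup (normSet_bddAbove ν) ⟨Y, i1, i2, N, f, hN, hf0, hf, c, hc, rfl⟩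
    have h1 : N (a.sum fun x c => c • f x) ^ (p : ℝ) ≤ pnorm μ ^ (p : ℝ) + pnorm ν ^ (p : ℝ) := by
      rw [hs]
      exact (hN.add _ _).trans (add_le_add
        (Real.rpow_le_rpow (IsPNorm.nonneg' hN _) hb' hp.le)
        (Real.rpow_le_rpow (IsPNorm.nonneg' hN _) hc' hp.le))
    have h2 := Real.rpow_le_rpow (Real.rpow_nonneg (IsPNorm.nonneg' hN _) _) h1
      (one_div_nonneg.2 hp.le)
    rwa [← Real.rpow_mul (IsPNorm.nonneg' hN _), mul_one_div_cancel hp.ne', Real.rpow_one] at h2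
  have h3 := Real.rpow_le_rpow (pnorm_nonneg _) h hp.le
  rwa [← Real.rpow_mul hnn, one_div_mul_cancel hp.ne', Real.rpow_one] at h3

theorem pnorm_smul_le (c : ℝ) (μ : PSpan p ρ o) : pnorm (c • μ) ≤ |c| * pnorm μ := by
  refine Real.sSup_le ?_ (mul_nonneg (abs_nonneg _) (pnorm_nonneg _))
  rintro r ⟨Y, i1, i2, N, f, hN, hf0, hf, a, ha, rfl⟩
  obtain ⟨b, hb⟩ := exists_rep μ
  have hs : (a.sum fun x c => c • f x) = c • b.sum fun x c => c • f x := by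
    rw [rep_unique (p := p) (ρ := ρ) (b := c • b) _ f hf0]
    · exact sum_smul_smul c b f
    · rw [ha, sum_smul_smul, hb]
  rw [hs, hN.smul]
  exact mul_le_mul_of_nonneg_left
    (le_csSup (normSet_bddAbove μ) ⟨Y, i1, i2, N, f, hN, hf0, hf, b, hb, rfl⟩) (abs_nonneg _)

/-- The `p`-th power of the `p`-seminorm is a subadditive function which defines the topology. -/
def powSeminorm : AddGroupSeminorm (PSpan p ρ o) where
  toFun μ := pnorm μ ^ (p : ℝ)
  map_zero' := by
    have h : pnorm (0 : PSpan p ρ o) = 0 := by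
      have := pnorm_smul_le 0 (0 : PSpan p ρ o)
      rw [zero_smul, abs_zero, zero_mul] at this
      exact le_antisymm this (pnorm_nonneg _)
    rw [h, Real.zero_rpow p.2.1.ne']
  add_le' := pnorm_add
  neg' μ := by
    have h : ∀ ν : PSpan p ρ o, pnorm (-ν) ≤ pnorm ν := fun ν => by
      have := pnorm_smul_le (-1) ν
      rwa [neg_one_smul, abs_neg, abs_one, one_mul] at this
    have h' := h (-μ)
    rw [neg_neg] at h'
    rw [le_antisymm (h μ) h']

/-- The translation-invariant pseudometric `‖μ - ν‖ ^ p` on the span of the evaluations. -/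
instance : SeminormedAddCommGroup (PSpan p ρ o) :=
  powSeminorm.toSeminormedAddCommGroup

theorem norm_eq (μ : PSpan p ρ o) : ‖μ‖ = pnorm μ ^ (p : ℝ) := rfl

instance : UniformContinuousConstSMul ℝ (PSpan p ρ o) where
  uniformContinuous_const_smul c := by
    refine (LipschitzWith.of_dist_le_mul (K := (|c| ^ (p : ℝ)).toNNReal) fun μ ν => ?_).uniformContinuous
    rw [dist_eq_norm, dist_eq_norm, ← smul_sub, norm_eq, norm_eq,
      Real.coe_toNNReal _ (Real.rpow_nonneg (abs_nonneg _) _),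
      ← Real.mul_rpow (abs_nonneg _) (pnorm_nonneg _)]
    exact Real.rpow_le_rpow (pnorm_nonneg _) (pnorm_smul_le c _) p.2.1.le

end LipFree

/-- The Lipschitz free `p`-space over a `p`-metric space `(M, ρ)` with base point `o`: the
completion of the span of the evaluations for the metric `‖μ - ν‖ ^ p`. -/
abbrev LipschitzFree {M : Type*} (p : Set.Ioc (0 : ℝ) 1) (ρ : M → M → ℝ) (o : M) : Type _ :=
  UniformSpace.Completion (LipFree.PSpan p ρ o)

/-- The `p`-norm of the Lipschitz free `p`-space. The norm `‖·‖` that the completion carries in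
Mathlib is the `p`-th power of the `p`-norm, hence the exponent `1 / p`. -/
def LipschitzFree.pnorm {M : Type*} {p : Set.Ioc (0 : ℝ) 1} {ρ : M → M → ℝ} {o : M}
    (x : LipschitzFree p ρ o) : ℝ :=
  ‖x‖ ^ (1 / (p : ℝ))

/-- The `p`-norm of the completion extends the `p`-norm of the span of the evaluations. -/
theorem LipschitzFree.pnorm_coe {M : Type*} {p : Set.Ioc (0 : ℝ) 1} {ρ : M → M → ℝ} {o : M}
    (μ : LipFree.PSpan p ρ o) :
    LipschitzFree.pnorm (μ : LipschitzFree p ρ o) = LipFree.pnorm μ := by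
  rw [LipschitzFree.pnorm, UniformSpace.Completion.norm_coe, LipFree.norm_eq,
    ← Real.rpow_mul (LipFree.pnorm_nonneg _), mul_one_div_cancel p.2.1.ne', Real.rpow_one]

theorem LipFree.pnorm_smul {M : Type*} {p : Set.Ioc (0 : ℝ) 1} {ρ : M → M → ℝ} {o : M}
    (c : ℝ) (μ : LipFree.PSpan p ρ o) : LipFree.pnorm (c • μ) = |c| * LipFree.pnorm μ := by
  refine le_antisymm (LipFree.pnorm_smul_le c μ) ?_
  rcases eq_or_ne c 0 with rfl | hc
  · simpa using LipFree.pnorm_nonneg _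
  · have h := LipFree.pnorm_smul_le c⁻¹ (c • μ)
    rw [inv_smul_smul₀ hc, abs_inv] at h
    have hc' : 0 < |c| := abs_pos.2 hc
    calc |c| * LipFree.pnorm μ ≤ |c| * (|c|⁻¹ * LipFree.pnorm (c • μ)) := by gcongr
      _ = _ := by field_simp

/-- The Lipschitz free `p`-space is a `p`-Banach space: it is complete by construction, and its
`p`-norm is a `p`-norm. -/
theorem LipschitzFree.isPNorm {M : Type*} {p : Set.Ioc (0 : ℝ) 1} {ρ : M → M → ℝ} {o : M} :
    IsPNorm (p : ℝ) (LipschitzFree.pnorm : LipschitzFree p ρ o → ℝ) where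
  pos x hx := Real.rpow_pos_of_pos (norm_pos_iff.2 hx) _
  smul c x := by
    refine UniformSpace.Completion.induction_on x ?_ fun μ => ?_
    · have hcont : Continuous (LipschitzFree.pnorm : LipschitzFree p ρ o → ℝ) :=
        continuous_norm.rpow_const fun _ => Or.inr (one_div_nonneg.2 p.2.1.le)
      exact isClosed_eq (hcont.comp (continuous_const_smul c)) (continuous_const.mul hcont)
    · rw [← UniformSpace.Completion.coe_smul, LipschitzFree.pnorm_coe, LipschitzFree.pnorm_coe,
        LipFree.pnorm_smul]
  add x y := by
    have h : ∀ z : LipschitzFree p ρ o, LipschitzFree.pnorm z ^ (p : ℝ) = ‖z‖ := fun z => by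
      rw [LipschitzFree.pnorm, ← Real.rpow_mul (norm_nonneg _), one_div_mul_cancel p.2.1.ne',
        Real.rpow_one]
    rw [h, h, h]
    exact norm_add_le x y

end

noncomputable section
namespace LipFree

universe u

section Biorthogonal

variable {M : Type u} {p : Set.Ioc (0 : ℝ) 1} {ρ : M → M → ℝ} {o : M}

theorem norm_smul_completion (c : ℝ) (x : LipschitzFree p ρ o) :
    ‖c • x‖ = |c| ^ (p : ℝ) * ‖x‖ := by
  have hp := p.2.1
  have h := congrArg (fun t => t ^ (p : ℝ)) (LipschitzFree.isPNorm.smul c x)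
  simp only [LipschitzFree.pnorm] at h
  rwa [Real.mul_rpow (abs_nonneg _) (Real.rpow_nonneg (norm_nonneg _) _),
    ← Real.rpow_mul (norm_nonneg _), ← Real.rpow_mul (norm_nonneg _),
    one_div_mul_cancel hp.ne', Real.rpow_one, Real.rpow_one] at h

/-- The evaluation of the elements of the span at a function vanishing at the base point. -/
def PSpan.eval (g : R0 o) : PSpan p ρ o →ₗ[ℝ] ℝ :=
  (LinearMap.applyₗ g).comp (PSpan.incl p ρ o)

theorem PSpan.eval_delta (g : R0 o) (x : M) :
    PSpan.eval g (PSpan.delta p ρ o x) = (g : M → ℝ) x := rfl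

theorem continuous_of_rpow_bound (φ : PSpan p ρ o →ₗ[ℝ] ℝ) (K : ℝ)
    (h : ∀ μ, |φ μ| ^ (p : ℝ) ≤ K * ‖μ‖) : Continuous φ := by
  have hp := p.2.1
  refine continuous_of_continuousAt_zero φ.toAddMonoidHom ?_
  have hb : ∀ μ, ‖φ μ‖ ≤ (K * ‖μ‖) ^ (1 / (p : ℝ)) := fun μ => by
    have h2 := Real.rpow_le_rpow (Real.rpow_nonneg (abs_nonneg _) _) (h μ)
      (one_div_nonneg.2 hp.le)
    rwa [← Real.rpow_mul (abs_nonneg _), mul_one_div_cancel hp.ne', Real.rpow_one] at h2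
  have hc : Continuous fun μ : PSpan p ρ o => (K * ‖μ‖) ^ (1 / (p : ℝ)) :=
    (continuous_const.mul continuous_norm).rpow_const fun _ => Or.inr (one_div_nonneg.2 hp.le)
  have h0 := hc.tendsto 0
  rw [norm_zero, mul_zero, Real.zero_rpow (one_div_pos.2 hp).ne'] at h0
  have := squeeze_zero_norm hb h0
  simpa [ContinuousAt] using this

/-- The continuous extension of a linear functional to the completion. -/
def extendFunctional (φ : PSpan p ρ o →ₗ[ℝ] ℝ) (hφ : Continuous φ) :
    LipschitzFree p ρ o →ₗ[ℝ] ℝ where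
  toFun := AddMonoidHom.extension φ.toAddMonoidHom hφ
  map_add' := map_add _
  map_smul' c x := by
    have hc := AddMonoidHom.continuous_extension φ.toAddMonoidHom hφ
    refine UniformSpace.Completion.induction_on x ?_ fun μ => ?_
    · exact isClosed_eq (hc.comp (continuous_const_smul c)) (hc.const_smul c)
    · rw [← UniformSpace.Completion.coe_smul]
      refine (AddMonoidHom.extension_coe φ.toAddMonoidHom hφ (c • μ)).trans ?_
      refine (map_smul φ c μ).trans (congrArg (c • ·) ?_)
      exact (AddMonoidHom.extension_coe φ.toAddMonoidHom hφ μ).symm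

theorem extendFunctional_coe (φ : PSpan p ρ o →ₗ[ℝ] ℝ) (hφ : Continuous φ) (μ : PSpan p ρ o) :
    extendFunctional φ hφ (μ : LipschitzFree p ρ o) = φ μ :=
  AddMonoidHom.extension_coe φ.toAddMonoidHom hφ μ

theorem continuous_extendFunctional (φ : PSpan p ρ o →ₗ[ℝ] ℝ) (hφ : Continuous φ) :
    Continuous (extendFunctional φ hφ) :=
  AddMonoidHom.continuous_extension φ.toAddMonoidHom hφ

/-- A bounded sequence in the span of the evaluations whose closed linear span is the whole free
space, and which has a biorthogonal sequence of functions with a `p`-summing bound, is equivalent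
to the unit vector basis of `ℓ_p`. -/
theorem quasiNormIsomorphic_lp_of_biorthogonal (g : ℕ → R0 o) (m : ℕ → PSpan p ρ o)
    {K : ℝ} (hK : 1 ≤ K)
    (hg : ∀ (μ : PSpan p ρ o) (s : Finset ℕ), ∑ n ∈ s, |PSpan.eval (g n) μ| ^ (p : ℝ) ≤ K * ‖μ‖)
    (hm : ∀ n, ‖m n‖ ≤ 1)
    (hgm : ∀ k n, PSpan.eval (g n) (m k) = if k = n then 1 else 0)
    (hdense : ∀ V : Submodule ℝ (LipschitzFree p ρ o), IsClosed (V : Set (LipschitzFree p ρ o)) →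
      (∀ n, (m n : LipschitzFree p ρ o) ∈ V) → V = ⊤) :
    QuasiNormIsomorphic (LipschitzFree.pnorm : LipschitzFree p ρ o → ℝ)
      (fun x : lp (fun _ : ℕ => ℝ) (ENNReal.ofReal p) => ‖x‖) := by
  have hp := p.2.1
  have hpr : (ENNReal.ofReal (p : ℝ)).toReal = p := ENNReal.toReal_ofReal hp.le
  have hpr0 : 0 < (ENNReal.ofReal (p : ℝ)).toReal := by rwa [hpr]
  have hcont : ∀ n, Continuous (PSpan.eval (p := p) (ρ := ρ) (g n)) := fun n =>
    continuous_of_rpow_bound _ K fun μ => by simpa using hg μ {n}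
  set c : ℕ → LipschitzFree p ρ o →ₗ[ℝ] ℝ := fun n => extendFunctional _ (hcont n) with hc
  have hcc : ∀ n, Continuous (c n) := fun n => continuous_extendFunctional _ _
  have hcm : ∀ k n, c n (m k) = if k = n then 1 else 0 := fun k n => by
    rw [hc]
    exact (extendFunctional_coe _ _ _).trans (hgm k n)
  have hcs : ∀ (y : LipschitzFree p ρ o) (s : Finset ℕ), ∑ n ∈ s, |c n y| ^ (p : ℝ) ≤ K * ‖y‖ := by
    intro y s
    refine UniformSpace.Completion.induction_on y ?_ fun μ => ?_
    · refine isClosed_le (continuous_finsetSum _ fun n _ => ?_)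
        (continuous_const.mul continuous_norm)
      exact (hcc n).abs.rpow_const fun _ => Or.inr hp.le
    · rw [UniformSpace.Completion.norm_coe]
      refine le_trans (le_of_eq (Finset.sum_congr rfl fun n _ => ?_)) (hg μ s)
      rw [hc]
      exact congrArg (fun t => |t| ^ (p : ℝ)) (extendFunctional_coe _ _ _)
  have hcn : ∀ y : LipschitzFree p ρ o, 0 ≤ fun n => |c n y| ^ (p : ℝ) := fun y n =>
    Real.rpow_nonneg (abs_nonneg _) _
  have hmem : ∀ y : LipschitzFree p ρ o, Memℓp (fun n => c n y) (ENNReal.ofReal (p : ℝ)) := by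
    intro y
    refine memℓp_gen ?_
    rw [hpr]
    exact summable_of_sum_le (hcn y) (hcs y)
  let T : LipschitzFree p ρ o →ₗ[ℝ] lp (fun _ : ℕ => ℝ) (ENNReal.ofReal (p : ℝ)) :=
    { toFun := fun y => ⟨fun n => c n y, hmem y⟩
      map_add' := fun x y => by ext n; exact map_add (c n) x y
      map_smul' := fun t y => by ext n; exact map_smul (c n) t y }
  have hTn : ∀ y, ‖T y‖ ^ (p : ℝ) ≤ K * ‖y‖ := by
    intro y
    have h := lp.norm_rpow_eq_tsum hpr0 (T y)
    rw [hpr] at h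
    rw [h]
    exact Real.tsum_le_of_sum_le (hcn y) (hcs y)
  have hasum : ∀ a : lp (fun _ : ℕ => ℝ) (ENNReal.ofReal (p : ℝ)),
      HasSum (fun n => |a n| ^ (p : ℝ)) (‖a‖ ^ (p : ℝ)) := by
    intro a
    have h := lp.hasSum_norm hpr0 a
    rw [hpr] at h
    exact h
  have hbd : ∀ (a : lp (fun _ : ℕ => ℝ) (ENNReal.ofReal (p : ℝ))) (n : ℕ),
      ‖a n • (m n : LipschitzFree p ρ o)‖ ≤ |a n| ^ (p : ℝ) := by
    intro a n
    rw [norm_smul_completion, UniformSpace.Completion.norm_coe]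
    exact mul_le_of_le_one_right (Real.rpow_nonneg (abs_nonneg _) _) (hm n)
  have hsum : ∀ a : lp (fun _ : ℕ => ℝ) (ENNReal.ofReal (p : ℝ)),
      Summable fun n => a n • (m n : LipschitzFree p ρ o) := fun a =>
    Summable.of_norm_bounded (hasum a).summable (hbd a)
  let S : lp (fun _ : ℕ => ℝ) (ENNReal.ofReal (p : ℝ)) →ₗ[ℝ] LipschitzFree p ρ o :=
    { toFun := fun a => ∑' n, a n • (m n : LipschitzFree p ρ o)
      map_add' := fun a b => by
        rw [← (hsum a).tsum_add (hsum b)]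
        refine tsum_congr fun n => ?_
        rw [lp.coeFn_add, Pi.add_apply, add_smul]
      map_smul' := fun t a => by
        rw [RingHom.id_apply, ← (hsum a).tsum_const_smul t]
        refine tsum_congr fun n => ?_
        rw [lp.coeFn_smul, Pi.smul_apply, smul_assoc] }
  have hSn : ∀ a, ‖S a‖ ≤ ‖a‖ ^ (p : ℝ) := fun a => tsum_of_norm_bounded (hasum a) (hbd a)
  have hTS : ∀ a, T (S a) = a := by
    intro a
    ext n
    have h1 : HasSum (fun k => c n (a k • (m k : LipschitzFree p ρ o))) (c n (S a)) :=
      (hsum a).hasSum.map (c n) (hcc n)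
    have h2 : HasSum (fun k => c n (a k • (m k : LipschitzFree p ρ o))) (a n) := by
      convert hasSum_single n fun k hk => ?_ using 1
      · rw [map_smul, hcm, if_pos rfl, smul_eq_mul, mul_one]
      · rw [map_smul, hcm, if_neg hk, smul_zero]
    exact h1.unique h2
  have hcST : Continuous fun y => S (T y) := by
    refine continuous_of_continuousAt_zero (S.comp T).toAddMonoidHom ?_
    have h0 : Filter.Tendsto (fun y : LipschitzFree p ρ o => K * ‖y‖) (nhds 0) (nhds 0) := by
      have hc : Continuous fun y : LipschitzFree p ρ o => K * ‖y‖ :=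
        continuous_const.mul continuous_norm
      have := hc.tendsto 0
      rwa [norm_zero, mul_zero] at this
    have := squeeze_zero_norm (fun y => (hSn (T y)).trans (hTn y)) h0
    change Filter.Tendsto (fun y => S (T y)) (nhds 0) (nhds (S (T 0)))
    rwa [map_zero, map_zero]
  have hST : ∀ y, S (T y) = y := by
    have h := hdense (LinearMap.eqLocus (S.comp T) LinearMap.id)
      (isClosed_eq hcST continuous_id) fun k => ?_
    · intro y
      have hy : y ∈ (⊤ : Submodule ℝ (LipschitzFree p ρ o)) := trivial
      rw [← h] at hy
      exact hy
    · change ∑' n, c n (m k) • (m n : LipschitzFree p ρ o) = m k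
      rw [tsum_eq_single k fun n hn => by rw [hcm, if_neg hn.symm, zero_smul], hcm, if_pos rfl,
        one_smul]
  refine ⟨LinearEquiv.ofLinearMap T S (LinearMap.ext hTS) (LinearMap.ext hST),
    K ^ (1 / (p : ℝ)), Real.rpow_pos_of_pos (by linarith) _, fun y => ?_, fun a => ?_⟩
  · have h := Real.rpow_le_rpow (Real.rpow_nonneg (lp.norm_nonneg' _) _) (hTn y)
      (one_div_nonneg.2 hp.le)
    rwa [← Real.rpow_mul (lp.norm_nonneg' _), mul_one_div_cancel hp.ne', Real.rpow_one,
      Real.mul_rpow (by linarith) (norm_nonneg _)] at h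
  · have h := Real.rpow_le_rpow (norm_nonneg _) (hSn a) (one_div_nonneg.2 hp.le)
    rw [← Real.rpow_mul (lp.norm_nonneg' _), mul_one_div_cancel hp.ne', Real.rpow_one] at h
    exact h.trans (le_mul_of_one_le_left (lp.norm_nonneg' _)
      (Real.one_le_rpow hK (one_div_nonneg.2 hp.le)))

theorem pnorm_delta_sub_le (hρ : ∀ x y, 0 ≤ ρ x y) (x y : M) :
    pnorm (PSpan.delta p ρ o x - PSpan.delta p ρ o y) ≤ ρ x y := by
  refine Real.sSup_le ?_ (hρ x y)
  rintro r ⟨Y, _, _, N, f, hN, hf0, hf, a, ha, rfl⟩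
  rw [rep_unique (p := p) (ρ := ρ) (b := Finsupp.single x 1 - Finsupp.single y 1) _ f hf0]
  · rw [Finsupp.sum_sub_index fun x c d => sub_smul c d _]
    simpa using hf x y
  · rw [ha, Finsupp.sum_sub_index fun x c d => sub_smul c d _]
    simp

theorem delta_base : PSpan.delta p ρ o o = 0 := by
  refine PSpan.incl_injective ?_
  rw [map_zero]
  ext f
  exact f.2

/-- The `p`-norm `(∑ |v i| ^ p) ^ (1 / p)` on a finite-dimensional coordinate space. -/
theorem isPNorm_finite {ι : Type} [Fintype ι] :
    IsPNorm (p : ℝ) (fun v : ULift.{u} (ι → ℝ) =>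
      (∑ i, |v.down i| ^ (p : ℝ)) ^ (1 / (p : ℝ))) := by
  have hp := p.2.1
  have hnn : ∀ (v : ULift.{u} (ι → ℝ)), 0 ≤ ∑ i, |v.down i| ^ (p : ℝ) := fun v =>
    Finset.sum_nonneg fun i _ => Real.rpow_nonneg (abs_nonneg _) _
  refine ⟨fun v hv => ?_, fun c v => ?_, fun v w => ?_⟩
  · obtain ⟨i, hi⟩ : ∃ i, v.down i ≠ 0 := by
      by_contra! h
      exact hv (ULift.ext _ _ (funext h))
    refine Real.rpow_pos_of_pos ?_ _
    exact Finset.sum_pos' (fun i _ => Real.rpow_nonneg (abs_nonneg _) _)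
      ⟨i, Finset.mem_univ _, Real.rpow_pos_of_pos (abs_pos.2 hi) _⟩
  · have h : ∑ i, |(c • v).down i| ^ (p : ℝ) = |c| ^ (p : ℝ) * ∑ i, |v.down i| ^ (p : ℝ) := by
      rw [Finset.mul_sum]
      refine Finset.sum_congr rfl fun i _ => ?_
      rw [ULift.smul_down, Pi.smul_apply, smul_eq_mul, abs_mul,
        Real.mul_rpow (abs_nonneg _) (abs_nonneg _)]
    rw [h, Real.mul_rpow (Real.rpow_nonneg (abs_nonneg _) _) (hnn v),
      ← Real.rpow_mul (abs_nonneg _), mul_one_div_cancel hp.ne', Real.rpow_one]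
  · rw [← Real.rpow_mul (hnn _), ← Real.rpow_mul (hnn _), ← Real.rpow_mul (hnn _),
      one_div_mul_cancel hp.ne', Real.rpow_one, Real.rpow_one, Real.rpow_one,
      ← Finset.sum_add_distrib]
    refine Finset.sum_le_sum fun i _ => ?_
    rw [ULift.add_down, Pi.add_apply]
    exact (Real.rpow_le_rpow (abs_nonneg _) (abs_add_le _ _) hp.le).trans
      (Real.rpow_add_le_add_rpow (abs_nonneg _) (abs_nonneg _) hp.le p.2.2)

/-- Finitely many functions which together form a Lipschitz map into `ℓ_p` extend to a bounded
operator on the span of the evaluations. -/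
theorem sum_eval_rpow_le {ι : Type} (g : ι → R0 o) (s : Finset ι) {K : ℝ} (hK : 0 < K)
    (hρ : ∀ x y, 0 ≤ ρ x y)
    (hg : ∀ x y, ∑ n ∈ s, |(g n : M → ℝ) x - (g n : M → ℝ) y| ^ (p : ℝ) ≤ K * ρ x y ^ (p : ℝ))
    (μ : PSpan p ρ o) : ∑ n ∈ s, |PSpan.eval (g n) μ| ^ (p : ℝ) ≤ K * ‖μ‖ := by
  have hp := p.2.1
  obtain ⟨a, ha⟩ := exists_rep μ
  set L : ℝ := K ^ (1 / (p : ℝ)) with hL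
  have hL0 : 0 < L := Real.rpow_pos_of_pos hK _
  have hLp : L ^ (p : ℝ) = K := by
    rw [hL, ← Real.rpow_mul hK.le, one_div_mul_cancel hp.ne', Real.rpow_one]
  let N : ULift.{u} (s → ℝ) → ℝ := fun v => (∑ i, |v.down i| ^ (p : ℝ)) ^ (1 / (p : ℝ))
  have hN : IsPNorm (p : ℝ) N := isPNorm_finite
  have hNp : ∀ v, N v ^ (p : ℝ) = ∑ i, |v.down i| ^ (p : ℝ) := fun v => by
    have h0 : 0 ≤ ∑ i, |v.down i| ^ (p : ℝ) :=
      Finset.sum_nonneg fun i _ => Real.rpow_nonneg (abs_nonneg _) _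
    rw [← Real.rpow_mul h0, one_div_mul_cancel hp.ne', Real.rpow_one]
  let f : M → ULift.{u} (s → ℝ) := fun x => L⁻¹ • ULift.up fun n : s => (g n : M → ℝ) x
  have hf0 : f o = 0 := by
    refine ULift.ext _ _ (funext fun n => ?_)
    change L⁻¹ * (g n : M → ℝ) o = 0
    rw [(g n).2, mul_zero]
  have hf : ∀ x y, N (f x - f y) ≤ ρ x y := by
    intro x y
    have h1 : f x - f y = L⁻¹ • ULift.up fun n : s => (g n : M → ℝ) x - (g n : M → ℝ) y := by
      exact (smul_sub L⁻¹ _ _).symm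
    rw [h1, hN.smul, abs_of_pos (inv_pos.2 hL0), inv_mul_le_iff₀ hL0]
    rw [← Real.rpow_le_rpow_iff (IsPNorm.nonneg' hN _) (mul_nonneg hL0.le (hρ x y)) hp, hNp,
      Real.mul_rpow hL0.le (hρ x y), hLp]
    refine le_trans (le_of_eq ?_) (hg x y)
    exact Finset.sum_coe_sort s fun n => |(g n : M → ℝ) x - (g n : M → ℝ) y| ^ (p : ℝ)
  have h2 : N (a.sum fun x c => c • f x) ≤ pnorm μ :=
    le_csSup (normSet_bddAbove μ) ⟨_, _, _, N, f, hN, hf0, hf, a, ha, rfl⟩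
  have h3 : (a.sum fun x c => c • f x) = L⁻¹ • ULift.up fun n : s => PSpan.eval (g n) μ := by
    refine ULift.ext _ _ (funext fun n => ?_)
    have h4 : ((a.sum fun x c => c • f x) : ULift.{u} (s → ℝ)).down n =
        a.sum fun x c => c * (L⁻¹ * (g n : M → ℝ) x) :=
      map_finsuppSum (LinearMap.proj (R := ℝ) (φ := fun _ : s => ℝ) n ∘ₗ
        (ULift.moduleEquiv (R := ℝ) (M := s → ℝ)).toLinearMap) a fun x c => c • f x
    rw [h4, ← ha]
    change _ = L⁻¹ * PSpan.eval (g n) _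
    rw [Finsupp.sum, Finsupp.sum, map_sum, Finset.mul_sum]
    refine Finset.sum_congr rfl fun x _ => ?_
    rw [map_smul, PSpan.eval_delta, smul_eq_mul]
    ring
  rw [h3, hN.smul, abs_of_pos (inv_pos.2 hL0), inv_mul_le_iff₀ hL0] at h2
  have h5 := Real.rpow_le_rpow (IsPNorm.nonneg' hN _) h2 hp.le
  rw [hNp, Real.mul_rpow hL0.le (pnorm_nonneg _), hLp, ← norm_eq] at h5
  refine le_trans (le_of_eq ?_) h5
  exact (Finset.sum_coe_sort s fun n => |PSpan.eval (g n) μ| ^ (p : ℝ)).symm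

end Biorthogonal
end LipFree
end

noncomputable section

/-- The least power of `2` above a positive real; `0` for the other reals. -/
def dyadicCeil (t : ℝ) : ℝ := if 0 < t then (2 : ℝ) ^ Int.clog 2 t else 0

theorem dyadicCeil_of_pos {t : ℝ} (ht : 0 < t) : dyadicCeil t = (2 : ℝ) ^ Int.clog 2 t :=
  if_pos ht

theorem dyadicCeil_pos {t : ℝ} (ht : 0 < t) : 0 < dyadicCeil t := by
  rw [dyadicCeil_of_pos ht]
  positivity

theorem dyadicCeil_zero : dyadicCeil 0 = 0 := if_neg (lt_irrefl _)

theorem dyadicCeil_nonneg (t : ℝ) : 0 ≤ dyadicCeil t := by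
  unfold dyadicCeil
  split_ifs <;> positivity

theorem monotone_dyadicCeil : Monotone dyadicCeil := by
  intro s t hst
  by_cases hs : 0 < s
  · rw [dyadicCeil_of_pos hs, dyadicCeil_of_pos (hs.trans_le hst)]
    exact zpow_le_zpow_right₀ one_le_two (Int.clog_mono_right hs hst)
  · rw [dyadicCeil, if_neg hs]
    exact dyadicCeil_nonneg t

theorem le_dyadicCeil (t : ℝ) : t ≤ dyadicCeil t := by
  by_cases ht : 0 < t
  · rw [dyadicCeil_of_pos ht]
    exact_mod_cast Int.self_le_zpow_clog one_lt_two t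
  · rw [dyadicCeil, if_neg ht]
    exact not_lt.1 ht

theorem dyadicCeil_le {t : ℝ} (ht : 0 ≤ t) : dyadicCeil t ≤ 2 * t := by
  rcases ht.eq_or_lt with rfl | ht
  · simp [dyadicCeil_zero]
  · have h := Int.zpow_pred_clog_lt_self (b := 2) one_lt_two ht
    rw [dyadicCeil_of_pos ht]
    push_cast at h
    rw [zpow_sub_one₀ two_ne_zero] at h
    linarith

/-- The `p`-th powers of distinct powers of `2` below `2 ^ k` add up to at most a constant multiple
of the `p`-th power of `2 ^ k`. -/
theorem sum_zpow_rpow_le {p : ℝ} (hp : 0 < p) {ι : Type*} (s : Finset ι) (e : ι → ℤ) (k : ℤ)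
    (he : Set.InjOn e s) (hk : ∀ i ∈ s, e i ≤ k) :
    ∑ i ∈ s, ((2 : ℝ) ^ e i) ^ p ≤ (1 - (2 : ℝ) ^ (-p))⁻¹ * ((2 : ℝ) ^ k) ^ p := by
  classical
  have hq0 : 0 ≤ (2 : ℝ) ^ (-p) := by positivity
  have hq1 : (2 : ℝ) ^ (-p) < 1 := Real.rpow_lt_one_of_one_lt_of_neg one_lt_two (neg_lt_zero.2 hp)
  have hterm : ∀ i ∈ s, ((2 : ℝ) ^ e i) ^ p =
      ((2 : ℝ) ^ (-p)) ^ (k - e i).toNat * ((2 : ℝ) ^ k) ^ p := by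
    intro i hi
    have h1 : (((k - e i).toNat : ℤ) : ℝ) = (k : ℝ) - e i := by
      rw [Int.toNat_of_nonneg (sub_nonneg.2 (hk i hi)), Int.cast_sub]
    rw [Int.cast_natCast] at h1
    rw [← Real.rpow_natCast, ← Real.rpow_intCast, ← Real.rpow_intCast,
      ← Real.rpow_mul zero_le_two, ← Real.rpow_mul zero_le_two, ← Real.rpow_mul zero_le_two,
      ← Real.rpow_add two_pos, h1]
    congr 1
    ring
  rw [Finset.sum_congr rfl hterm, ← Finset.sum_mul]
  refine mul_le_mul_of_nonneg_right ?_ (by positivity)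
  have hinj : Set.InjOn (fun i => (k - e i).toNat) (s : Set ι) := by
    intro i hi j hj hij
    have h1 := hk i hi
    have h2 := hk j hj
    have h3 : (k - e i).toNat = (k - e j).toNat := hij
    exact he hi hj (by omega)
  rw [← Finset.sum_image (f := fun j : ℕ => ((2 : ℝ) ^ (-p)) ^ j) hinj,
    ← tsum_geometric_of_lt_one hq0 hq1]
  exact (summable_geometric_of_lt_one hq0 hq1).sum_le_tsum _ fun j _ => pow_nonneg hq0 j

namespace UltrametricRecords

/-- A sequence of distinct points in a set with an ultrametric `ρ`, and for every term but the
first the earliest of the preceding terms which is nearest to it. -/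
structure NearestParent {M : Type*} (ρ : M → M → ℝ) (x : ℕ → M) (parent : ℕ → ℕ) : Prop where
  self : ∀ y, ρ y y = 0
  pos : ∀ y z, y ≠ z → 0 < ρ y z
  symm : ∀ y z, ρ y z = ρ z y
  ultra : ∀ y z w, ρ y w ≤ max (ρ y z) (ρ z w)
  injective : Function.Injective x
  parent_le : ∀ n, parent n ≤ n
  nearest : ∀ n, ∀ k ≤ n, ρ (x (n + 1)) (x (parent n)) ≤ ρ (x (n + 1)) (x k)
  earliest : ∀ n, ∀ k < parent n, ρ (x (n + 1)) (x (parent n)) < ρ (x (n + 1)) (x k)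

theorem exists_parent (f : ℕ → ℕ → ℝ) : ∃ parent : ℕ → ℕ, (∀ n, parent n ≤ n) ∧
    (∀ n, ∀ k ≤ n, f n (parent n) ≤ f n k) ∧ ∀ n, ∀ k < parent n, f n (parent n) < f n k := by
  classical
  have h : ∀ n, ∃ j ≤ n, ∀ k ≤ n, f n j ≤ f n k := fun n => by
    obtain ⟨j, hj, hmin⟩ := Finset.exists_min_image (Finset.range (n + 1)) (f n) ⟨0, by simp⟩
    exact ⟨j, Nat.lt_succ_iff.1 (Finset.mem_range.1 hj), fun k hk =>
      hmin k (Finset.mem_range.2 (Nat.lt_succ_iff.2 hk))⟩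
  refine ⟨fun n => Nat.find (h n), fun n => (Nat.find_spec (h n)).1,
    fun n => (Nat.find_spec (h n)).2, fun n k hk => ?_⟩
  by_contra! hle
  have hkn : k ≤ n := hk.le.trans (Nat.find_spec (h n)).1
  exact Nat.find_min (h n) hk ⟨hkn, fun i hi => hle.trans ((Nat.find_spec (h n)).2 i hi)⟩

variable {M : Type*} {ρ : M → M → ℝ} {x : ℕ → M} {parent : ℕ → ℕ}

/-- The index `n + 1` is a record of `y` if `x (n + 1)` is nearer to `y` than all preceding terms
of the sequence. -/
def IsRecord (ρ : M → M → ℝ) (x : ℕ → M) (y : M) (n : ℕ) : Prop :=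
  ∀ k ≤ n, ρ (x (n + 1)) y < ρ (x k) y

/-- The distance of `x (n + 1)` to the preceding terms. -/
def gap (ρ : M → M → ℝ) (x : ℕ → M) (parent : ℕ → ℕ) (n : ℕ) : ℝ :=
  ρ (x (n + 1)) (x (parent n))

open Classical in
/-- The function with value `gap n` at the points which have the record `n + 1`, and zero
elsewhere. -/
def bump (ρ : M → M → ℝ) (x : ℕ → M) (parent : ℕ → ℕ) (n : ℕ) (y : M) : ℝ :=
  if IsRecord ρ x y n then gap ρ x parent n else 0

namespace NearestParent

variable (h : NearestParent ρ x parent)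
include h

theorem nonneg (y z : M) : 0 ≤ ρ y z := by
  by_cases hyz : y = z
  · rw [hyz, h.self]
  · exact (h.pos y z hyz).le

theorem gap_pos (n : ℕ) : 0 < gap ρ x parent n :=
  h.pos _ _ fun he => by
    have h1 := h.injective he
    have h2 := h.parent_le n
    omega

theorem gap_le_of_isRecord {y : M} {n : ℕ} (hn : IsRecord ρ x y n) {k : ℕ} (hk : k ≤ n) :
    gap ρ x parent n ≤ ρ (x k) y := by
  refine (h.nearest n k hk).trans ((h.ultra _ y _).trans (max_le (hn k hk).le ?_))
  rw [h.symm]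

theorem lt_gap_of_isRecord {y : M} {n : ℕ} (hn : IsRecord ρ x y n) :
    ρ (x (n + 1)) y < gap ρ x parent n := by
  have h1 := hn _ (h.parent_le n)
  rcases le_max_iff.1 (h.ultra (x (parent n)) (x (n + 1)) y) with h2 | h2
  · rw [h.symm (x (parent n)) (x (n + 1))] at h2
    exact h1.trans_le h2
  · exact absurd h1 (not_lt.2 h2)

theorem isRecord_of_lt_gap {y z : M} {n : ℕ} (hn : IsRecord ρ x y n)
    (hyz : ρ y z < gap ρ x parent n) : IsRecord ρ x z n := by
  intro k hk
  have h1 := h.gap_le_of_isRecord hn hk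
  have h2 : ρ (x (n + 1)) z < ρ (x k) y :=
    (h.ultra _ y _).trans_lt (max_lt (hn k hk) (hyz.trans_le h1))
  refine h2.trans_le ?_
  rcases le_max_iff.1 (h.ultra (x k) z y) with h3 | h3
  · exact h3
  · rw [h.symm z y] at h3
    exact absurd (hyz.trans_le (h1.trans h3)) (lt_irrefl _)

theorem gap_lt_gap {y : M} {n n' : ℕ} (hn : IsRecord ρ x y n) (hn' : IsRecord ρ x y n')
    (hlt : n < n') : gap ρ x parent n' < gap ρ x parent n :=
  (h.gap_le_of_isRecord hn' hlt).trans_lt (h.lt_gap_of_isRecord hn)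

theorem injOn_gap (y : M) : Set.InjOn (gap ρ x parent) {n | IsRecord ρ x y n} := by
  intro n hn n' hn' he
  rcases lt_trichotomy n n' with hlt | heq | hlt
  · exact absurd he (h.gap_lt_gap hn hn' hlt).ne'
  · exact heq
  · exact absurd he (h.gap_lt_gap hn' hn hlt).ne

theorem bump_zero (n : ℕ) : bump ρ x parent n (x 0) = 0 := by
  refine if_neg fun hn => ?_
  have h1 := hn 0 (Nat.zero_le n)
  rw [h.self] at h1
  exact absurd h1 (not_lt.2 (h.nonneg _ _))

theorem lt_of_isRecord {n j : ℕ} (hn : IsRecord ρ x (x j) n) : n < j := by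
  by_contra! hle
  have h1 := hn j hle
  rw [h.self] at h1
  exact absurd h1 (not_lt.2 (h.nonneg _ _))

theorem isRecord_self (n : ℕ) : IsRecord ρ x (x (n + 1)) n := by
  intro k hk
  rw [h.self]
  exact h.pos _ _ fun he => by
    have := h.injective he
    omega

theorem isRecord_succ_iff {j n : ℕ} (hnj : n ≠ j) :
    IsRecord ρ x (x (j + 1)) n ↔ IsRecord ρ x (x (parent j)) n := by
  constructor
  · intro hn
    have hlt : n < j := by
      have := h.lt_of_isRecord hn
      omega
    refine h.isRecord_of_lt_gap hn ((h.nearest j (n + 1) hlt).trans_lt ?_)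
    rw [h.symm]
    exact h.lt_gap_of_isRecord hn
  · intro hn
    refine h.isRecord_of_lt_gap hn ?_
    have hlt := h.lt_of_isRecord hn
    have hp : parent n < parent j := (h.parent_le n).trans_lt hlt
    have h1 := h.earliest j _ hp
    have h2 : ρ (x (parent n)) (x (parent j)) ≤ gap ρ x parent n := by
      refine (h.ultra _ (x (n + 1)) _).trans (max_le ?_ (h.lt_gap_of_isRecord hn).le)
      rw [h.symm]
      exact le_rfl
    rw [h.symm (x (parent j))]
    rcases le_max_iff.1 (h.ultra (x (j + 1)) (x (parent j)) (x (parent n))) with h3 | h3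
    · exact absurd h1 (not_lt.2 h3)
    · rw [h.symm (x (parent j))] at h3
      exact h1.trans_le (h3.trans h2)

theorem bump_succ_sub_bump_parent (j n : ℕ) :
    bump ρ x parent n (x (j + 1)) - bump ρ x parent n (x (parent j)) =
      if j = n then gap ρ x parent j else 0 := by
  classical
  by_cases hjn : j = n
  · subst hjn
    have h1 : ¬ IsRecord ρ x (x (parent j)) j := fun hn =>
      absurd (h.lt_of_isRecord hn) (not_lt.2 (h.parent_le j))
    rw [bump, bump, if_pos (h.isRecord_self j), if_neg h1, if_pos rfl, sub_zero]
  · have he : bump ρ x parent n (x (j + 1)) = bump ρ x parent n (x (parent j)) := by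
      rw [bump, bump]
      exact if_congr (h.isRecord_succ_iff (Ne.symm hjn)) rfl rfl
    rw [he, sub_self, if_neg hjn]

theorem sum_gap_rpow_le {p : ℝ} (hp : 0 < p) (hdy : ∀ y z, y ≠ z → ∃ k : ℤ, ρ y z = (2 : ℝ) ^ k)
    {y z : M} (hyz : y ≠ z) (w : M) (s : Finset ℕ) (hs : ∀ n ∈ s, IsRecord ρ x w n)
    (hle : ∀ n ∈ s, gap ρ x parent n ≤ ρ y z) :
    ∑ n ∈ s, gap ρ x parent n ^ p ≤ (1 - (2 : ℝ) ^ (-p))⁻¹ * ρ y z ^ p := by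
  obtain ⟨k, hk⟩ := hdy y z hyz
  have he : ∀ n, ∃ e : ℤ, gap ρ x parent n = (2 : ℝ) ^ e := fun n =>
    hdy _ _ fun he => by
      have h1 := h.injective he
      have h2 := h.parent_le n
      omega
  choose e he using he
  rw [hk, Finset.sum_congr rfl fun n _ => congrArg (· ^ p) (he n)]
  refine sum_zpow_rpow_le hp s e k (fun n hn n' hn' hnn => ?_) fun n hn => ?_
  · refine h.injOn_gap w (hs n hn) (hs n' hn') ?_
    rw [he, he, hnn]
  · have := hle n hn
    rwa [he, hk, zpow_le_zpow_iff_right₀ one_lt_two] at this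

/-- The functions `bump n` together form a Lipschitz map into `ℓ_p`. -/
theorem sum_bump_sub_rpow_le {p : ℝ} (hp : 0 < p)
    (hdy : ∀ y z, y ≠ z → ∃ k : ℤ, ρ y z = (2 : ℝ) ^ k) (s : Finset ℕ) (y z : M) :
    ∑ n ∈ s, |bump ρ x parent n y - bump ρ x parent n z| ^ p ≤
      2 * (1 - (2 : ℝ) ^ (-p))⁻¹ * ρ y z ^ p := by
  classical
  by_cases hyz : y = z
  · subst hyz
    simp [Real.zero_rpow hp.ne', h.self]
  have hterm : ∀ n, |bump ρ x parent n y - bump ρ x parent n z| ^ p =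
      (if IsRecord ρ x y n ∧ ¬ IsRecord ρ x z n then gap ρ x parent n ^ p else 0) +
        if IsRecord ρ x z n ∧ ¬ IsRecord ρ x y n then gap ρ x parent n ^ p else 0 := by
    intro n
    by_cases h1 : IsRecord ρ x y n <;> by_cases h2 : IsRecord ρ x z n <;>
      simp [bump, h1, h2, Real.zero_rpow hp.ne', abs_of_pos (h.gap_pos n)]
  rw [Finset.sum_congr rfl fun n _ => hterm n, Finset.sum_add_distrib, ← Finset.sum_filter,
    ← Finset.sum_filter, two_mul, add_mul]
  refine add_le_add (h.sum_gap_rpow_le hp hdy hyz y _ ?_ ?_)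
    (h.sum_gap_rpow_le hp hdy hyz z _ ?_ ?_)
  · exact fun n hn => (Finset.mem_filter.1 hn).2.1
  · intro n hn
    by_contra! hlt
    exact (Finset.mem_filter.1 hn).2.2 (h.isRecord_of_lt_gap (Finset.mem_filter.1 hn).2.1 hlt)
  · exact fun n hn => (Finset.mem_filter.1 hn).2.1
  · intro n hn
    by_contra! hlt
    rw [h.symm] at hlt
    exact (Finset.mem_filter.1 hn).2.2 (h.isRecord_of_lt_gap (Finset.mem_filter.1 hn).2.1 hlt)

end NearestParent
end UltrametricRecords

/-- An infinite separable metric space has a dense sequence of distinct points with any given first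
term. -/
theorem exists_injective_denseRange {M : Type*} [MetricSpace M]
    [TopologicalSpace.SeparableSpace M] [Infinite M] (o : M) :
    ∃ x : ℕ → M, x 0 = o ∧ Function.Injective x ∧ DenseRange x := by
  classical
  obtain ⟨S, hSc, hSd⟩ := TopologicalSpace.exists_countable_dense M
  have hSi : S.Infinite := fun hf => by
    have h := hSd.closure_eq
    rw [hf.isClosed.closure_eq] at h
    exact Set.infinite_univ (h ▸ hf)
  have hD : Dense (insert o S) := hSd.mono (Set.subset_insert _ _)
  have : Countable ↥(insert o S) := (hSc.insert o).to_subtype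
  have : Infinite ↥(insert o S) := (hSi.mono (Set.subset_insert _ _)).to_subtype
  obtain ⟨e⟩ : Nonempty (ℕ ≃ ↥(insert o S)) := nonempty_equiv_of_countable
  let e' := (Equiv.swap 0 (e.symm ⟨o, Set.mem_insert _ _⟩)).trans e
  refine ⟨fun n => e' n, ?_, Subtype.val_injective.comp e'.injective, ?_⟩
  · simp [e']
  · refine hD.mono fun y hy => ⟨e'.symm ⟨y, hy⟩, by simp⟩

end

open LipFree UltrametricRecords in
/-- The Lipschitz free `p`-space over an infinite separable pointed ultrametric space is
isomorphic to `ℓ_p` for every `0 < p ≤ 1`. -/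
theorem theorem5p1 {M : Type*} [MetricSpace M] [IsUltrametricDist M]
    [TopologicalSpace.SeparableSpace M] [Infinite M] (o : M) (p : ℝ) (hp : p ∈ Set.Ioc (0 : ℝ) 1) :
    QuasiNormIsomorphic
      (LipschitzFree.pnorm : LipschitzFree ⟨p, hp⟩ (dist : M → M → ℝ) o → ℝ)
      (fun x : lp (fun _ : ℕ => ℝ) (ENNReal.ofReal p) => ‖x‖) := by
  have hp0 : 0 < p := hp.1
  obtain ⟨x, hx0, hxi, hxd⟩ := exists_injective_denseRange o
  set ρ : M → M → ℝ := fun y z => dyadicCeil (dist y z) with hρ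
  obtain ⟨parent, hpar⟩ := exists_parent fun n k => ρ (x (n + 1)) (x k)
  have h : NearestParent ρ x parent :=
    { self := fun y => by simp only [hρ, dist_self, dyadicCeil_zero]
      pos := fun y z hyz => dyadicCeil_pos (dist_pos.2 hyz)
      symm := fun y z => by simp only [hρ, dist_comm]
      ultra := fun y z w => by
        simp only [hρ, ← monotone_dyadicCeil.map_max]
        exact monotone_dyadicCeil (dist_triangle_max y z w)
      injective := hxi
      parent_le := hpar.1
      nearest := hpar.2.1
      earliest := hpar.2.2 }
  have hdy : ∀ y z, y ≠ z → ∃ k : ℤ, ρ y z = (2 : ℝ) ^ k := fun y z hyz =>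
    ⟨_, dyadicCeil_of_pos (dist_pos.2 hyz)⟩
  have hq : (2 : ℝ) ^ (-p) < 1 := Real.rpow_lt_one_of_one_lt_of_neg one_lt_two (neg_lt_zero.2 hp0)
  have hq0 : 0 < (2 : ℝ) ^ (-p) := by positivity
  have hG : 1 ≤ (1 - (2 : ℝ) ^ (-p))⁻¹ := (one_le_inv₀ (by linarith)).2 (by linarith)
  have h2p : 1 ≤ (2 : ℝ) ^ p := Real.one_le_rpow one_le_two hp0.le
  set K : ℝ := 2 * (1 - (2 : ℝ) ^ (-p))⁻¹ * (2 : ℝ) ^ p with hK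
  have hK1 : 1 ≤ K := by
    have : 1 ≤ 2 * (1 - (2 : ℝ) ^ (-p))⁻¹ := by linarith
    exact one_le_mul_of_one_le_of_one_le this h2p
  let g : ℕ → R0 o := fun n => ⟨bump ρ x parent n, by
    change bump ρ x parent n o = 0
    rw [← hx0]
    exact h.bump_zero n⟩
  let δ : M → PSpan ⟨p, hp⟩ (dist : M → M → ℝ) o := PSpan.delta _ _ _
  have hδ : ∀ y z, ‖δ y - δ z‖ ≤ dist y z ^ p := fun y z =>
    Real.rpow_le_rpow (pnorm_nonneg _) (pnorm_delta_sub_le (fun _ _ => dist_nonneg) y z) hp0.le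
  have hδc : Continuous δ := by
    refine continuous_iff_continuousAt.2 fun y => tendsto_iff_norm_sub_tendsto_zero.2 ?_
    refine squeeze_zero (fun z => norm_nonneg _) (fun z => hδ z y) ?_
    have hc : Continuous fun z => dist z y ^ p :=
      (continuous_id.dist continuous_const).rpow_const fun _ => Or.inr hp0.le
    have := hc.tendsto y
    rwa [dist_self, Real.zero_rpow hp0.ne'] at this
  let r : ℕ → ℝ := gap ρ x parent
  have hr : ∀ n, 0 < r n := h.gap_pos
  let m : ℕ → PSpan ⟨p, hp⟩ (dist : M → M → ℝ) o := fun n =>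
    (r n)⁻¹ • (δ (x (n + 1)) - δ (x (parent n)))
  refine quasiNormIsomorphic_lp_of_biorthogonal g m hK1 (fun μ s => ?_) (fun n => ?_)
    (fun k n => ?_) fun V hV hmV => ?_
  · refine sum_eval_rpow_le g s (by linarith) (fun _ _ => dist_nonneg) (fun y z => ?_) μ
    refine (h.sum_bump_sub_rpow_le hp0 hdy s y z).trans ?_
    change _ ≤ K * dist y z ^ p
    rw [hK, mul_assoc _ ((2 : ℝ) ^ p), ← Real.mul_rpow zero_le_two dist_nonneg]
    refine mul_le_mul_of_nonneg_left ?_ (by linarith)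
    exact Real.rpow_le_rpow (dyadicCeil_nonneg _) (dyadicCeil_le dist_nonneg) hp0.le
  · refine Real.rpow_le_one (pnorm_nonneg _) ?_ hp0.le
    rw [pnorm_smul, abs_of_pos (inv_pos.2 (hr n)), inv_mul_le_iff₀ (hr n), mul_one]
    exact (pnorm_delta_sub_le (fun _ _ => dist_nonneg) _ _).trans (le_dyadicCeil _)
  · have he := h.bump_succ_sub_bump_parent k n
    rw [map_smul, map_sub, PSpan.eval_delta, PSpan.eval_delta]
    change (r k)⁻¹ * (bump ρ x parent n (x (k + 1)) - bump ρ x parent n (x (parent k))) = _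
    rw [he]
    split_ifs
    · exact inv_mul_cancel₀ (hr k).ne'
    · exact mul_zero _
  · have hseq : ∀ n, (δ (x n) : LipschitzFree ⟨p, hp⟩ (dist : M → M → ℝ) o) ∈ V := by
      intro n
      induction n using Nat.strong_induction_on with
      | _ n ih =>
        rcases n with _ | n
        · have h0 : δ (x 0) = 0 := by
            rw [hx0]
            exact delta_base
          rw [h0, UniformSpace.Completion.coe_zero]
          exact V.zero_mem
        · have h1 : δ (x (n + 1)) = r n • m n + δ (x (parent n)) := by
            rw [smul_inv_smul₀ (hr n).ne', sub_add_cancel]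
          rw [h1, UniformSpace.Completion.coe_add, UniformSpace.Completion.coe_smul]
          exact V.add_mem (V.smul_mem _ (hmV n)) (ih _ (Nat.lt_succ_of_le (h.parent_le n)))
    have hall : ∀ y, (δ y : LipschitzFree ⟨p, hp⟩ (dist : M → M → ℝ) o) ∈ V := fun y =>
      hxd.induction_on (p := fun y => (δ y : LipschitzFree ⟨p, hp⟩ (dist : M → M → ℝ) o) ∈ V) y
        (hV.preimage ((UniformSpace.Completion.continuous_coe _).comp hδc)) hseq
    refine eq_top_iff.2 fun y _ => ?_
    refine UniformSpace.Completion.induction_on y hV fun μ => ?_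
    obtain ⟨a, rfl⟩ := exists_rep μ
    refine Finsupp.induction_linear a ?_ (fun b c hb hc => ?_) fun z c => ?_
    · rw [Finsupp.sum_zero_index, UniformSpace.Completion.coe_zero]
      exact V.zero_mem
    · rw [sum_add_smul, UniformSpace.Completion.coe_add]
      exact V.add_mem hb hc
    · have h1 : ((Finsupp.single z c).sum fun y t => t • δ y) = c • δ z :=
        Finsupp.sum_single_index (zero_smul ℝ (δ z))
      rw [h1, UniformSpace.Completion.coe_smul]
      exact V.smul_mem _ (hall z)
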